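/- Let $G=(V,E)$ be a simple, undirected, connected graph (finite or infinite) in which every vertex has the same finite degree $d$. Write $d(x,y)$ for the combinatorial distance, $S_r(x)=\{z\in V: d(x,z)=r\}$, and for $p\in[0,1]$ let $\mu_x^p$ be the probability distribution with $\mu_x^p(x)=p$, $\mu_x^p(z)=\frac{1-p}{d}$ for $z\sim x$, and $\mu_x^p(z)=0$ otherwise. For an edge $\{x,y\}$ put $\kappa_p(x,y)=1-W_1(\mu_x^p,\mu_y^p)$, where $W_1$ is the Wasserstein distance with respect to $d(\cdot,\cdot)$, and $\kappa_{LLY}(x,y)=\lim_{p\to1^-}\frac{\kappa_p(x,y)}{1-p}$. For $f,g:V\to\mathbb{R}$ put $\Delta f(x)=\sum_{y\sim x}(f(y)-f(x))$, $2\Gamma(f,g)=\Delta(fg)-f\Delta g-g\Delta f$ and $2\Gamma_2(f,g)=\Delta\Gamma(f,g)-\Gamma(f,\Delta g)-\Gamma(\Delta f,g)$. For $0<N<\infty$ let $\mathcal{K}(x,N)$ be the largest real $K$ such that $\Gamma_2(f,f)(x)\ge\frac1N(\Delta f(x))^2+K\,\Gamma(f,f)(x)$ for all $f:V\to\mathbb{R}$,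 and put $\mathcal{K}_\infty(x)=\lim_{N\to\infty}\mathcal{K}(x,N)$. The graph $G$ is called distance-regular if $|S_r(x)\cap S_t(y)|$ depends only on $r$, $t$ and $d(x,y)$, for all $x,y\in V$ and all integers $r,t\ge0$. **Theorem.** (a) If $G$ is distance-regular of girth $4$, then $$\kappa_0(x,y)=0\quad\text{and}\quad\kappa_{LLY}(x,y)=\frac2d\quad\text{for all }\{x,y\}\in E,\qquad\text{and}\qquad \mathcal{K}_\infty(x)=2\quad\text{for all }x\in V.$$ (b) These are the maximal values possible for triangle-free $d$-regular graphs: if $d\ge1$ and $G$ contains no triangle, then $$\kappa_0(x,y)\le0\quad\text{and}\quad\kappa_{LLY}(x,y)\le\frac2d\quad\text{for all }\{x,y\}\in E,\qquad\text{and}\qquad \mathcal{K}_\infty(x)\le2\quad\text{for all }x\in V.$$ Here the limits defining $\kappa_{LLY}(x,y)$ and $\mathcal{K}_\infty(x)$, and the maxima $\mathcal{K}(x,N)$, exist as real numbers in both (a) and (b). -/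

import Mathlib

open Filter Topology

namespace GraphCurvature

variable {V : Type*}

/-- A graph is distance-regular if it is regular and, for all vertices `x, y` and radii `r, t`,
the cardinality of `S_r(x) ∩ S_t(y)` depends only on `r`, `t` and `d(x, y)`. -/
def IsDistanceRegular (G : SimpleGraph V) [G.LocallyFinite] : Prop :=
  (∃ k : ℕ, G.IsRegularOfDegree k) ∧
    ∃ N : ℕ → ℕ → ℕ → ℕ, ∀ (x y : V) (r t : ℕ),
      {z : V | G.dist x z = r ∧ G.dist y z = t}.encard = N r t (G.dist x y)

/-! ### Ollivier-Ricci curvature -/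

open Classical in
/-- The probability distribution `μ_x^p` with idleness `p`, as a mass function on `V`. -/
noncomputable def idleMass (G : SimpleGraph V) [G.LocallyFinite] (p : ℝ) (x z : V) : ℝ :=
  if z = x then p else if G.Adj x z then (1 - p) / (G.degree x : ℝ) else 0

/-- `π` is a transport plan from the mass function `μ₁` to the mass function `μ₂`. -/
structure IsTransportPlan (μ₁ μ₂ : V → ℝ) (π : V → V → ℝ) : Prop where
  nonneg : ∀ u v, 0 ≤ π u v
  fst : ∀ u, HasSum (fun v => π u v) (μ₁ u)
  snd : ∀ v, HasSum (fun u => π u v) (μ₂ v)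

/-- The Wasserstein distance for the combinatorial distance of `G`: the infimum of the (finite)
costs of transport plans. -/
noncomputable def wasserstein (G : SimpleGraph V) (μ₁ μ₂ : V → ℝ) : ℝ :=
  sInf {c : ℝ | ∃ π : V → V → ℝ, IsTransportPlan μ₁ μ₂ π ∧
    HasSum (fun q : V × V => (G.dist q.1 q.2 : ℝ) * π q.1 q.2) c}

/-- The `p`-Ollivier-Ricci curvature `κ_p(x, y)`. -/
noncomputable def ollivier (G : SimpleGraph V) [G.LocallyFinite] (p : ℝ) (x y : V) : ℝ :=
  1 - wasserstein G (idleMass G p x) (idleMass G p y)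

/-- The limit of `κ_p(x, y) / (1 - p)` as `p → 1` in `[0, 1)` exists and equals `κ`, that is,
the Lin-Lu-Yau curvature `κ_LLY(x, y)` is `κ`. -/
def IsLLYCurvature (G : SimpleGraph V) [G.LocallyFinite] (x y : V) (κ : ℝ) : Prop :=
  Tendsto (fun p : ℝ => ollivier G p x y / (1 - p)) (𝓝[<] 1) (𝓝 κ)

/-! ### Bakry-Émery curvature -/

/-- The non-normalized Laplacian. -/
def lap (G : SimpleGraph V) [G.LocallyFinite] (f : V → ℝ) (x : V) : ℝ :=
  ∑ y ∈ G.neighborFinset x, (f y - f x)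

/-- `2 Γ(f, g) = Δ(f g) - f Δ g - g Δ f`. -/
noncomputable def Gam (G : SimpleGraph V) [G.LocallyFinite] (f g : V → ℝ) (x : V) : ℝ :=
  (lap G (fun z => f z * g z) x - f x * lap G g x - g x * lap G f x) / 2

/-- `2 Γ₂(f, g) = Δ Γ(f, g) - Γ(f, Δ g) - Γ(Δ f, g)`. -/
noncomputable def Gam₂ (G : SimpleGraph V) [G.LocallyFinite] (f g : V → ℝ) (x : V) : ℝ :=
  (lap G (Gam G f g) x - Gam G f (lap G g) x - Gam G (lap G f) g x) / 2

/-- The curvature-dimension inequality `CD(K, N)` at the vertex `x`, for finite `N > 0`. -/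
def CDAt (G : SimpleGraph V) [G.LocallyFinite] (x : V) (K N : ℝ) : Prop :=
  ∀ f : V → ℝ, 1 / N * lap G f x ^ 2 + K * Gam G f f x ≤ Gam₂ G f f x

/-- The Bakry-Émery curvature `K_∞(x)` equals `k`: for every finite `N > 0` there is a largest
real `K(x, N)` for which `CD(K(x, N), N)` holds at `x`, and `K(x, N) → k` as `N → ∞`. -/
def IsBECurvatureInfty (G : SimpleGraph V) [G.LocallyFinite] (x : V) (k : ℝ) : Prop :=
  ∃ K : ℝ → ℝ, (∀ N : ℝ, 0 < N → IsGreatest {c : ℝ | CDAt G x c N} (K N)) ∧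
    Tendsto K atTop (𝓝 k)

end GraphCurvature

namespace GraphCurvature

variable {V : Type*}

/-! Bakry-Émery side: on a `d`-regular graph, `four_mul_Gam₂` writes 4Γ₂ at x as the sum of the
squares ((f z - f x) - 2(f y - f x))² over paths x, y, z with z ≠ x, plus terms in the values on
N(x). Without triangles every such z is at distance 2 from x, so distance to x kills all the squares
and forces K(x, N) ≤ 2 - 2d/N.

Girth 4 and distance-regularity enter through two facts: there are no triangles, and distinct
nonadjacent vertices with a common neighbour all have the same number c + 1 ≥ 2 of them. Hence two
neighbours y, y' of x share c further vertices z, where the squares for y and y' together dominate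
2(f y - f y')². Double counting gives Γ₂ ≥ 2Γ (`two_mul_Gam_le_Gam₂`), and Cauchy-Schwarz turns this
into the extremal bound for every N.

Ollivier side: indicators are 1-Lipschitz, so a set separating the two measures bounds W₁ from
below. Conversely, the edges between N(x) \ {y} and N(y) \ {x} form a c-regular bipartite graph;
equal weights on them give a fractional perfect matching, a transport over distance 1
(`wasserstein_idleMass_le_of_common`).

In (b) the limits exist by monotonicity and boundedness: of K(x, N) in N, and of κ_p / (1 - p) in p
by convexity of W₁. -/

theorem not_adj_of_cliqueFree {G : SimpleGraph V} (hfree : G.CliqueFree 3) {x y z : V}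
    (hxy : G.Adj x y) (hyz : G.Adj y z) : ¬ G.Adj x z := by
  classical
  exact fun h => hfree {x, y, z} (SimpleGraph.is3Clique_triple_iff.2 ⟨hxy, h, hyz⟩)

/-! ### Γ-calculus on regular graphs and the bound for triangle-free graphs -/

variable (G : SimpleGraph V) [G.LocallyFinite]

theorem Gam_eq_sum (f g : V → ℝ) (x : V) :
    Gam G f g x = (∑ y ∈ G.neighborFinset x, (f y - f x) * (g y - g x)) / 2 := by
  unfold Gam lap
  rw [Finset.mul_sum, Finset.mul_sum, ← Finset.sum_sub_distrib, ← Finset.sum_sub_distrib]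
  congr 1
  exact Finset.sum_congr rfl fun y _ => by ring

variable {G} in
/-- The Cauchy-Schwarz bound of the Laplacian by the carré du champ. -/
theorem lap_sq_le {d : ℕ} (hreg : G.IsRegularOfDegree d) (f : V → ℝ) (x : V) :
    lap G f x ^ 2 ≤ 2 * d * Gam G f f x := by
  have h := sq_sum_le_card_mul_sum_sq (s := G.neighborFinset x) (f := fun y => f y - f x)
  rw [SimpleGraph.card_neighborFinset_eq_degree, hreg x] at h
  rw [Gam_eq_sum]
  unfold lap
  simp only [← pow_two]
  linarith

open Classical in
variable {G} in
/-- Explicit form of `4 Γ₂` on a regular graph. -/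
theorem four_mul_Gam₂ {d : ℕ} (hreg : G.IsRegularOfDegree d) (f : V → ℝ) (x : V) :
    4 * Gam₂ G f f x =
      (∑ y ∈ G.neighborFinset x, ∑ z ∈ (G.neighborFinset y).erase x,
        ((f z - f x) - 2 * (f y - f x)) ^ 2) +
      (4 - 2 * d) * (∑ y ∈ G.neighborFinset x, (f y - f x) ^ 2) + 2 * lap G f x ^ 2 := by
  have hcomm : Gam G (lap G f) f x = Gam G f (lap G f) x := by
    simp only [Gam_eq_sum, mul_comm]
  have hlap : lap G (Gam G f f) x =
      (∑ y ∈ G.neighborFinset x, (∑ z ∈ G.neighborFinset y, (f z - f y) ^ 2) / 2) -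
        d * ((∑ y ∈ G.neighborFinset x, (f y - f x) ^ 2) / 2) := by
    rw [lap, Finset.sum_sub_distrib, Finset.sum_const,
      SimpleGraph.card_neighborFinset_eq_degree, hreg x, nsmul_eq_mul]
    simp only [Gam_eq_sum, ← pow_two]
  have hgam : Gam G f (lap G f) x =
      ((∑ y ∈ G.neighborFinset x, (f y - f x) * lap G f y) - lap G f x ^ 2) / 2 := by
    rw [Gam_eq_sum]
    simp only [mul_sub]
    rw [Finset.sum_sub_distrib, ← Finset.sum_mul, pow_two]
    rfl
  -- The base is (f z - f y) - (f y - f x). Over all neighbours z of y its square gives the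
  -- coefficient d; the excluded z = x contributes 4(f y - f x)², hence d - 4.
  have key : ∀ y ∈ G.neighborFinset x,
      ∑ z ∈ (G.neighborFinset y).erase x, ((f z - f x) - 2 * (f y - f x)) ^ 2 =
      2 * ((∑ z ∈ G.neighborFinset y, (f z - f y) ^ 2) / 2) - 2 * ((f y - f x) * lap G f y)
        + (d - 4) * (f y - f x) ^ 2 := by
    intro y hy
    have hx : x ∈ G.neighborFinset y := by simpa [G.adj_comm] using hy
    have h := Finset.add_sum_erase _
      (fun z => ((f z - f x) - 2 * (f y - f x)) ^ 2) hx
    have h2 : ∑ z ∈ G.neighborFinset y, ((f z - f x) - 2 * (f y - f x)) ^ 2 =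
        (∑ z ∈ G.neighborFinset y, (f z - f y) ^ 2) - 2 * ((f y - f x) * lap G f y)
          + d * (f y - f x) ^ 2 := by
      have hd : (d : ℝ) * (f y - f x) ^ 2 = ∑ z ∈ G.neighborFinset y, (f y - f x) ^ 2 := by
        rw [Finset.sum_const, SimpleGraph.card_neighborFinset_eq_degree, hreg y, nsmul_eq_mul]
      rw [hd, lap, Finset.mul_sum, Finset.mul_sum, ← Finset.sum_sub_distrib,
        ← Finset.sum_add_distrib]
      exact Finset.sum_congr rfl fun z _ => by ring
    linear_combination h + h2
  rw [Finset.sum_congr rfl key, Finset.sum_add_distrib, Finset.sum_sub_distrib, ← Finset.mul_sum,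
    ← Finset.mul_sum, ← Finset.mul_sum, Gam₂, hcomm, hlap, hgam]
  ring

variable {G}

/-- A crude bound from dropping the squares; it only serves to make the set of admissible K
nonempty. -/
theorem Gam₂_ge {d : ℕ} (hreg : G.IsRegularOfDegree d) (f : V → ℝ) (x : V) :
    (2 - d) * Gam G f f x ≤ Gam₂ G f f x := by
  classical
  have h := four_mul_Gam₂ hreg f x
  have h1 : 0 ≤ ∑ y ∈ G.neighborFinset x, ∑ z ∈ (G.neighborFinset y).erase x,
        ((f z - f x) - 2 * (f y - f x)) ^ 2 :=
    Finset.sum_nonneg fun y _ => Finset.sum_nonneg fun z _ => sq_nonneg _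
  have h2 := Gam_eq_sum G f f x
  simp only [← pow_two] at h2
  have h3 := sq_nonneg (lap G f x)
  rw [h2]
  linarith

/-- The dimension term is absorbed by Cauchy-Schwarz, (Δf)² ≤ 2dΓ(f, f). With a = 2 the loss 2d/N
matches the upper bound `le_of_CDAt` exactly. -/
theorem CDAt_of_Gam₂_ge {d : ℕ} (hreg : G.IsRegularOfDegree d) {x : V} {a : ℝ}
    (h : ∀ f, a * Gam G f f x ≤ Gam₂ G f f x) {N : ℝ} (hN : 0 < N) :
    CDAt G x (a - 2 * d / N) N := by
  intro f
  have h1 := mul_le_mul_of_nonneg_left (lap_sq_le hreg f x) (one_div_pos.2 hN).le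
  calc _ ≤ 1 / N * (2 * d * Gam G f f x) + (a - 2 * d / N) * Gam G f f x := by gcongr
    _ = a * Gam G f f x := by ring
    _ ≤ _ := h f

/-- The test function `dist x ·` bounds the curvature at `x` of a triangle-free regular graph. -/
theorem le_of_CDAt {d : ℕ} (hreg : G.IsRegularOfDegree d) (hd : 0 < d) (hfree : G.CliqueFree 3)
    {x : V} {c N : ℝ} (h : CDAt G x c N) : c ≤ 2 - 2 * d / N := by
  classical
  let f : V → ℝ := fun z => if z = x then 0 else if G.Adj x z then 1 else 2
  have fx : f x = 0 := by simp [f]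
  have f1 : ∀ y ∈ G.neighborFinset x, f y = 1 := by
    intro y hy
    have hy' : G.Adj x y := by simpa using hy
    simp [f, hy'.ne', hy']
  have f2 : ∀ y ∈ G.neighborFinset x, ∀ z ∈ (G.neighborFinset y).erase x, f z = 2 := by
    intro y hy z hz
    rw [SimpleGraph.mem_neighborFinset] at hy
    rw [Finset.mem_erase, SimpleGraph.mem_neighborFinset] at hz
    simp [f, hz.1, not_adj_of_cliqueFree hfree hy hz.2]
  have hlap : lap G f x = d := by
    rw [lap, Finset.sum_congr rfl fun y hy => by rw [f1 y hy, fx]]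
    simp [hreg x]
  have hsq : ∑ y ∈ G.neighborFinset x, (f y - f x) ^ 2 = d := by
    rw [Finset.sum_congr rfl fun y hy => by rw [f1 y hy, fx]]
    simp [hreg x]
  have hG : Gam G f f x = d / 2 := by
    rw [Gam_eq_sum]
    simp only [← pow_two]
    rw [hsq]
  have hG2 := four_mul_Gam₂ hreg f x
  rw [Finset.sum_eq_zero fun y hy => Finset.sum_eq_zero fun z hz => by
    rw [f2 y hy z hz, f1 y hy, fx]; norm_num, hsq, hlap] at hG2
  have hc := h f
  rw [hG, hlap] at hc
  have hd' : (0 : ℝ) < d := Nat.cast_pos.2 hd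
  have h3 : d * (1 / N * d + c / 2) ≤ d * 1 := by linarith
  have h4 := le_of_mul_le_mul_left h3 hd'
  have h5 : 2 * (d : ℝ) / N = 2 * (1 / N * d) := by ring
  linarith

theorem isClosed_setOf_CDAt (x : V) (N : ℝ) : IsClosed {c : ℝ | CDAt G x c N} := by
  simp only [CDAt, Set.ofPred_forall]
  exact isClosed_iInter fun f => isClosed_le (by fun_prop) continuous_const

/-- The curvature `K_∞(x)` of a triangle-free regular graph exists and is at most `2`. -/
theorem exists_isBECurvatureInfty {d : ℕ} (hreg : G.IsRegularOfDegree d) (hd : 0 < d)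
    (hfree : G.CliqueFree 3) (x : V) : ∃ k : ℝ, IsBECurvatureInfty G x k ∧ k ≤ 2 := by
  have hgr : ∀ N : ℝ, 0 < N →
      IsGreatest {c : ℝ | CDAt G x c N} (sSup {c : ℝ | CDAt G x c N}) := by
    intro N hN
    have hb : BddAbove {c : ℝ | CDAt G x c N} := ⟨_, fun c hc => le_of_CDAt hreg hd hfree hc⟩
    have hne : {c : ℝ | CDAt G x c N}.Nonempty :=
      ⟨_, CDAt_of_Gam₂_ge hreg (fun f => Gam₂_ge hreg f x) hN⟩
    exact ⟨(isClosed_setOf_CDAt x N).csSup_mem hne hb, fun c hc => le_csSup hb hc⟩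
  have hle : ∀ N : ℝ, 0 < N → sSup {c : ℝ | CDAt G x c N} ≤ 2 := by
    intro N hN
    have h := le_of_CDAt hreg hd hfree (hgr N hN).1
    have : 0 ≤ 2 * (d : ℝ) / N := by positivity
    linarith
  -- Truncating at 1 keeps the dimension positive, so monotonicity holds on all of ℝ without
  -- changing the limit at infinity.
  have hmono : Monotone fun N : ℝ => sSup {c : ℝ | CDAt G x c (max N 1)} := by
    intro M N hMN
    have hM : 0 < max M 1 := lt_max_of_lt_right one_pos
    refine (hgr _ (lt_max_of_lt_right one_pos)).2 fun f => le_trans ?_ ((hgr _ hM).1 f)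
    gcongr
  obtain h | ⟨k, hk⟩ := tendsto_atTop_of_monotone hmono
  · obtain ⟨N, hN⟩ := (h.eventually_gt_atTop 2).exists
    exact absurd (hle _ (lt_max_of_lt_right one_pos)) (not_le.2 hN)
  · refine ⟨k, ⟨_, hgr, hk.congr' ?_⟩,
      le_of_tendsto' hk fun N => hle _ (lt_max_of_lt_right one_pos)⟩
    filter_upwards [eventually_ge_atTop 1] with N hN
    rw [max_eq_left hN]

/-! ### Common neighbours and the sharp Bakry-Émery bound -/

open Classical in
/-- Any two nonadjacent vertices with a common neighbour have exactly `c + 1` common neighbours. -/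
def HasConstantCommonNeighbors (G : SimpleGraph V) [G.LocallyFinite] (c : ℕ) : Prop :=
  ∀ u v w : V, u ≠ v → ¬ G.Adj u v → G.Adj u w → G.Adj w v →
    (G.neighborFinset u ∩ G.neighborFinset v).card = c + 1

open Classical in
theorem HasConstantCommonNeighbors.card_erase {c : ℕ} (h : HasConstantCommonNeighbors G c)
    {u v w : V} (huv : u ≠ v) (hadj : ¬ G.Adj u v) (huw : G.Adj u w) (hwv : G.Adj w v) :
    ((G.neighborFinset u ∩ G.neighborFinset v).erase w).card = c := by
  rw [Finset.card_erase_of_mem (by simp [huw, hwv.symm]), h u v w huv hadj huw hwv]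
  rfl

/-- Summing the pair inequality over ordered pairs (y, y') counts every square c times in each of
the two roles, so c cancels. What remains bounds the sum of squares below by 2d Σ g² - 2(Σ g)²,
which offsets the terms -2d Σ g² and 2(Δf)² in 4Γ₂. -/
theorem two_mul_Gam_le_Gam₂ {d c : ℕ} (hreg : G.IsRegularOfDegree d) (hc : 0 < c)
    (hfree : G.CliqueFree 3) (h : HasConstantCommonNeighbors G c) (f : V → ℝ) (x : V) :
    2 * Gam G f f x ≤ Gam₂ G f f x := by
  classical
  set S := G.neighborFinset x with hS
  set g : V → ℝ := fun z => f z - f x with hg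
  have hmem : ∀ {y}, y ∈ S ↔ G.Adj x y := by simp [hS]
  set Q : V → V → ℝ := fun y z => (g z - 2 * g y) ^ 2 with hQ
  -- common neighbours of two neighbours of `x`
  have hpair : ∀ y ∈ S, ∀ y' ∈ S,
      (c : ℝ) * (2 * (g y - g y') ^ 2) ≤
        ∑ z ∈ (G.neighborFinset y).erase x, if y' ≠ y ∧ G.Adj y' z then Q y z + Q y' z else 0 := by
    intro y hy y' hy'
    by_cases hne : y' = y
    · simp [hne]
    · have hcard := h.card_erase (w := x) (Ne.symm hne)
        (not_adj_of_cliqueFree hfree (hmem.1 hy).symm (hmem.1 hy')) (hmem.1 hy).symm (hmem.1 hy')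
      have hfil : ((G.neighborFinset y).erase x).filter (fun z => y' ≠ y ∧ G.Adj y' z) =
          (G.neighborFinset y ∩ G.neighborFinset y').erase x := by
        ext z; simp [hne]; tauto
      rw [← Finset.sum_filter, hfil, ← hcard, ← nsmul_eq_mul]
      refine Finset.card_nsmul_le_sum _ _ _ fun z _ => ?_
      simp only [hQ]
      -- The difference of the two sides is exactly twice this square.
      nlinarith [sq_nonneg (g z - (g y + g y'))]
  have hcount : ∀ y ∈ S, ∀ z ∈ (G.neighborFinset y).erase x,
      (S.filter fun y' => y' ≠ y ∧ G.Adj y' z).card = c := by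
    intro y hy z hz
    rw [Finset.mem_erase, SimpleGraph.mem_neighborFinset] at hz
    rw [← h.card_erase (Ne.symm hz.1) (not_adj_of_cliqueFree hfree (hmem.1 hy) hz.2)
      (hmem.1 hy) hz.2]
    congr 1
    ext y'
    simp [hS, G.adj_comm z]; tauto
  have hleft : ∑ y ∈ S, ∑ y' ∈ S, ∑ z ∈ (G.neighborFinset y).erase x,
      (if y' ≠ y ∧ G.Adj y' z then Q y z else 0) =
        c * ∑ y ∈ S, ∑ z ∈ (G.neighborFinset y).erase x, Q y z := by
    rw [Finset.mul_sum]
    refine Finset.sum_congr rfl fun y hy => ?_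
    rw [Finset.sum_comm, Finset.mul_sum]
    refine Finset.sum_congr rfl fun z hz => ?_
    rw [← Finset.sum_filter, Finset.sum_const, hcount y hy z hz, nsmul_eq_mul]
  have hright : ∑ y ∈ S, ∑ y' ∈ S, ∑ z ∈ (G.neighborFinset y).erase x,
      (if y' ≠ y ∧ G.Adj y' z then Q y' z else 0) =
        c * ∑ y ∈ S, ∑ z ∈ (G.neighborFinset y).erase x, Q y z := by
    -- Exchanging y and y' reduces to the previous count: z is a common neighbour of both, distinct
    -- from x.
    rw [← hleft, Finset.sum_comm]
    refine Finset.sum_congr rfl fun y hy => Finset.sum_congr rfl fun y' hy' => ?_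
    rw [← Finset.sum_filter, ← Finset.sum_filter]
    refine Finset.sum_congr ?_ fun _ _ => rfl
    ext z
    simp
    tauto
  have hsum := Finset.sum_le_sum fun y hy => Finset.sum_le_sum fun y' hy' => hpair y hy y' hy'
  have hsplit : ∀ y y' z, (if y' ≠ y ∧ G.Adj y' z then Q y z + Q y' z else 0) =
      (if y' ≠ y ∧ G.Adj y' z then Q y z else 0) + if y' ≠ y ∧ G.Adj y' z then Q y' z else 0 := by
    intro y y' z; split_ifs <;> simp
  simp only [hsplit, Finset.sum_add_distrib] at hsum
  rw [hleft, hright] at hsum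
  have hsq : ∑ y ∈ S, ∑ y' ∈ S, (c : ℝ) * (2 * (g y - g y') ^ 2) =
      c * (4 * (d * (∑ y ∈ S, g y ^ 2) - (∑ y ∈ S, g y) ^ 2)) := by
    have h1 : ∀ y y', (c : ℝ) * (2 * (g y - g y') ^ 2) =
        2 * c * g y ^ 2 + 2 * c * g y' ^ 2 - 4 * c * (g y * g y') := fun y y' => by ring
    simp only [h1, Finset.sum_sub_distrib, Finset.sum_add_distrib, Finset.sum_const,
      ← Finset.mul_sum, ← Finset.sum_mul, hS, SimpleGraph.card_neighborFinset_eq_degree, hreg x,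
      nsmul_eq_mul]
    ring
  rw [hsq] at hsum
  have hc' : (0 : ℝ) < c := Nat.cast_pos.2 hc
  have hfin := le_of_mul_le_mul_left (a := (c : ℝ))
    (b := 4 * (d * (∑ y ∈ S, g y ^ 2) - (∑ y ∈ S, g y) ^ 2))
    (c := 2 * ∑ y ∈ S, ∑ z ∈ (G.neighborFinset y).erase x, Q y z) (by linarith) hc'
  have h4 := four_mul_Gam₂ hreg f x
  have hGam := Gam_eq_sum G f f x
  simp only [← pow_two] at hGam
  have hlap : lap G f x = ∑ y ∈ S, g y := rfl
  rw [hGam]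
  rw [hlap] at h4
  linarith

theorem isBECurvatureInfty_two {d c : ℕ} (hreg : G.IsRegularOfDegree d) (hd : 0 < d) (hc : 0 < c)
    (hfree : G.CliqueFree 3) (h : HasConstantCommonNeighbors G c) (x : V) :
    IsBECurvatureInfty G x 2 := by
  refine ⟨fun N => 2 - 2 * d / N, fun N hN =>
    ⟨CDAt_of_Gam₂_ge hreg (fun f => two_mul_Gam_le_Gam₂ hreg hc hfree h f x) hN,
      fun _ hb => le_of_CDAt hreg hd hfree hb⟩, ?_⟩
  simpa using (tendsto_const_nhds (x := (2 : ℝ))).sub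
    ((tendsto_const_nhds (x := 2 * (d : ℝ))).div_atTop tendsto_id)

end GraphCurvature
namespace GraphCurvature

/-! ### Transport plans and weak Kantorovich duality -/

section Transport

variable {V : Type*} {G : SimpleGraph V} {μ₁ μ₂ : V → ℝ} {π : V → V → ℝ}

/-- The costs of the transport plans from `μ₁` to `μ₂` with summable cost. -/
def transportCosts (G : SimpleGraph V) (μ₁ μ₂ : V → ℝ) : Set ℝ :=
  {c : ℝ | ∃ π : V → V → ℝ, IsTransportPlan μ₁ μ₂ π ∧
    HasSum (fun q : V × V => (G.dist q.1 q.2 : ℝ) * π q.1 q.2) c}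

theorem IsTransportPlan.eq_zero_left (h : IsTransportPlan μ₁ μ₂ π) {u : V} (hu : μ₁ u = 0)
    (v : V) : π u v = 0 := by
  have h1 := h.fst u
  rw [hu] at h1
  exact congrFun ((hasSum_zero_iff_of_nonneg (h.nonneg u)).1 h1) v

theorem IsTransportPlan.eq_zero_right (h : IsTransportPlan μ₁ μ₂ π) {v : V} (hv : μ₂ v = 0)
    (u : V) : π u v = 0 := by
  have h1 := h.snd v
  rw [hv] at h1
  exact congrFun ((hasSum_zero_iff_of_nonneg (fun u => h.nonneg u v)).1 h1) u

theorem nonneg_of_mem_transportCosts {c : ℝ} (hc : c ∈ transportCosts G μ₁ μ₂) : 0 ≤ c := by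
  obtain ⟨π, h, hs⟩ := hc
  exact hs.nonneg fun q => mul_nonneg (Nat.cast_nonneg _) (h.nonneg _ _)

theorem wasserstein_le {c : ℝ} (hc : c ∈ transportCosts G μ₁ μ₂) : wasserstein G μ₁ μ₂ ≤ c :=
  csInf_le ⟨0, fun _ => nonneg_of_mem_transportCosts⟩ hc

/-- The easy half of Kantorovich duality, for finitely supported mass functions. -/
theorem le_of_mem_transportCosts {s : Finset V} (h₁ : ∀ u ∉ s, μ₁ u = 0) (h₂ : ∀ u ∉ s, μ₂ u = 0)
    {φ : V → ℝ} (hφ : ∀ u v, φ u - φ v ≤ G.dist u v) {c : ℝ} (hc : c ∈ transportCosts G μ₁ μ₂) :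
    ∑ u ∈ s, φ u * μ₁ u - ∑ u ∈ s, φ u * μ₂ u ≤ c := by
  obtain ⟨π, h, hs⟩ := hc
  have hcost : c = ∑ u ∈ s, ∑ v ∈ s, (G.dist u v : ℝ) * π u v := by
    rw [← Finset.sum_product']
    refine hs.unique (hasSum_sum_of_ne_finset_zero fun q hq => ?_)
    rw [Finset.mem_product, not_and_or] at hq
    rcases hq with hq | hq
    · rw [h.eq_zero_left (h₁ _ hq), mul_zero]
    · rw [h.eq_zero_right (h₂ _ hq), mul_zero]
  have hfst : ∀ u, μ₁ u = ∑ v ∈ s, π u v := fun u =>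
    (h.fst u).unique (hasSum_sum_of_ne_finset_zero fun v hv => h.eq_zero_right (h₂ v hv) u)
  have hsnd : ∀ v, μ₂ v = ∑ u ∈ s, π u v := fun v =>
    (h.snd v).unique (hasSum_sum_of_ne_finset_zero fun u hu => h.eq_zero_left (h₁ u hu) v)
  have e₂ : ∑ u ∈ s, φ u * μ₂ u = ∑ u ∈ s, ∑ v ∈ s, φ v * π u v := by
    rw [Finset.sum_comm]
    exact Finset.sum_congr rfl fun v _ => by rw [hsnd, Finset.mul_sum]
  have e₁ : ∑ u ∈ s, φ u * μ₁ u = ∑ u ∈ s, ∑ v ∈ s, φ u * π u v :=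
    Finset.sum_congr rfl fun u _ => by rw [hfst, Finset.mul_sum]
  rw [hcost, e₁, e₂, ← Finset.sum_sub_distrib]
  refine Finset.sum_le_sum fun u _ => ?_
  rw [← Finset.sum_sub_distrib]
  refine Finset.sum_le_sum fun v _ => ?_
  rw [← sub_mul]
  exact mul_le_mul_of_nonneg_right (hφ u v) (h.nonneg u v)

/-- Connectedness matters: `dist` is 0 between unreachable vertices. -/
theorem indicator_sub_le_dist (hconn : G.Connected) (A : Set V) [DecidablePred (· ∈ A)] (u v : V) :
    ((if u ∈ A then 1 else 0) - (if v ∈ A then 1 else 0) : ℝ) ≤ G.dist u v := by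
  by_cases huv : u = v
  · simp [huv]
  · have h1 : (1 : ℝ) ≤ G.dist u v := by exact_mod_cast hconn.pos_dist_of_ne huv
    split_ifs <;> linarith

/-- The product plan. -/
theorem transportCosts_nonempty {s : Finset V} (h₁ : ∀ u ∉ s, μ₁ u = 0) (h₂ : ∀ u ∉ s, μ₂ u = 0)
    (p₁ : ∀ u, 0 ≤ μ₁ u) (p₂ : ∀ u, 0 ≤ μ₂ u) (t₁ : ∑ u ∈ s, μ₁ u = 1)
    (t₂ : ∑ u ∈ s, μ₂ u = 1) : (transportCosts G μ₁ μ₂).Nonempty := by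
  have s₁ : HasSum μ₁ 1 := t₁ ▸ hasSum_sum_of_ne_finset_zero h₁
  have s₂ : HasSum μ₂ 1 := t₂ ▸ hasSum_sum_of_ne_finset_zero h₂
  refine ⟨_, fun u v => μ₁ u * μ₂ v, ⟨fun u v => mul_nonneg (p₁ u) (p₂ v), fun u => ?_, fun v => ?_⟩,
    hasSum_sum_of_ne_finset_zero (s := s ×ˢ s) fun q hq => ?_⟩
  · simpa using s₂.mul_left (μ₁ u)
  · simpa using s₁.mul_right (μ₂ v)
  · rw [Finset.mem_product, not_and_or] at hq
    rcases hq with hq | hq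
    · simp [h₁ _ hq]
    · simp [h₂ _ hq]

open Classical in
/-- Moving the mass `r` from `a` to `b`. -/
noncomputable def pointPlan (a b : V) (r : ℝ) (u v : V) : ℝ :=
  if u = a ∧ v = b then r else 0

theorem pointPlan_nonneg (a b : V) {r : ℝ} (hr : 0 ≤ r) (u v : V) : 0 ≤ pointPlan a b r u v := by
  unfold pointPlan
  split_ifs <;> simp [hr]

open Classical in
theorem hasSum_pointPlan_fst (a b : V) (r : ℝ) (u : V) :
    HasSum (fun v => pointPlan a b r u v) (if u = a then r else 0) := by
  by_cases h : u = a
  · simpa [pointPlan, h] using hasSum_ite_eq b r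
  · simp [pointPlan, h, hasSum_zero]

open Classical in
theorem hasSum_pointPlan_snd (a b : V) (r : ℝ) (v : V) :
    HasSum (fun u => pointPlan a b r u v) (if v = b then r else 0) := by
  by_cases h : v = b
  · simpa [pointPlan, h] using hasSum_ite_eq a r
  · simp [pointPlan, h, hasSum_zero]

open Classical in
theorem hasSum_pointPlan_cost (a b : V) (r : ℝ) :
    HasSum (fun q : V × V => (G.dist q.1 q.2 : ℝ) * pointPlan a b r q.1 q.2)
      (G.dist a b * r) := by
  convert hasSum_ite_eq (a, b) ((G.dist a b : ℝ) * r) using 2 with q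
  by_cases h : q.1 = a ∧ q.2 = b
  · simp [pointPlan, h, Prod.ext_iff]
  · simp [pointPlan, h, Prod.ext_iff]

end Transport

/-! ### Wasserstein distance between the idle measures -/

variable {V : Type*} {G : SimpleGraph V} [G.LocallyFinite]

open Classical in
theorem idleMass_apply {d : ℕ} (hreg : G.IsRegularOfDegree d) (p : ℝ) (x u : V) :
    idleMass G p x u = (if u = x then p else 0) + if G.Adj x u then (1 - p) / d else 0 := by
  unfold idleMass
  rw [hreg x]
  by_cases h : u = x
  · simp [h]
  · simp [h]

theorem idleMass_nonneg {p : ℝ} (hp : 0 ≤ p) (hp' : p ≤ 1) (x u : V) : 0 ≤ idleMass G p x u := by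
  unfold idleMass
  have : 0 ≤ 1 - p := by linarith
  split_ifs <;> positivity

open Classical in
theorem sum_mul_idleMass {d : ℕ} (hreg : G.IsRegularOfDegree d) (p : ℝ) (x : V) {s : Finset V}
    (hx : x ∈ s) (hs : G.neighborFinset x ⊆ s) (φ : V → ℝ) :
    ∑ u ∈ s, φ u * idleMass G p x u =
      p * φ x + (1 - p) / d * ∑ u ∈ G.neighborFinset x, φ u := by
  have hf : s.filter (fun u => G.Adj x u) = G.neighborFinset x := by
    ext u
    simpa using fun h : G.Adj x u => hs (by simpa using h)
  simp only [idleMass_apply hreg, mul_add, Finset.sum_add_distrib, mul_ite, mul_zero]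
  rw [Finset.sum_ite_eq' s x, if_pos hx, ← Finset.sum_filter, hf, ← Finset.sum_mul]
  ring

open Classical in
/-- A finite set containing the supports of `μ_x^p` and `μ_y^p`. -/
noncomputable def ballUnion (G : SimpleGraph V) [G.LocallyFinite] (x y : V) : Finset V :=
  insert x (insert y (G.neighborFinset x ∪ G.neighborFinset y))

theorem idleMass_eq_zero_left {p : ℝ} {x y u : V} (hu : u ∉ ballUnion G x y) :
    idleMass G p x u = 0 := by
  simp only [ballUnion, Finset.mem_insert, Finset.mem_union, SimpleGraph.mem_neighborFinset] at hu
  push Not at hu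
  simp [idleMass, hu]

theorem idleMass_eq_zero_right {p : ℝ} {x y u : V} (hu : u ∉ ballUnion G x y) :
    idleMass G p y u = 0 := by
  simp only [ballUnion, Finset.mem_insert, Finset.mem_union, SimpleGraph.mem_neighborFinset] at hu
  push Not at hu
  simp [idleMass, hu]

theorem sum_mul_idleMass_left {d : ℕ} (hreg : G.IsRegularOfDegree d) (p : ℝ) (x y : V)
    (φ : V → ℝ) : ∑ u ∈ ballUnion G x y, φ u * idleMass G p x u =
      p * φ x + (1 - p) / d * ∑ u ∈ G.neighborFinset x, φ u :=
  sum_mul_idleMass hreg p x (by simp [ballUnion]) (fun u hu => by simp_all [ballUnion]) φ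

theorem sum_mul_idleMass_right {d : ℕ} (hreg : G.IsRegularOfDegree d) (p : ℝ) (x y : V)
    (φ : V → ℝ) : ∑ u ∈ ballUnion G x y, φ u * idleMass G p y u =
      p * φ y + (1 - p) / d * ∑ u ∈ G.neighborFinset y, φ u :=
  sum_mul_idleMass hreg p y (by simp [ballUnion]) (fun u hu => by simp_all [ballUnion]) φ

theorem transportCosts_idleMass_nonempty {d : ℕ} (hreg : G.IsRegularOfDegree d) (hd : 0 < d)
    {p : ℝ} (hp : 0 ≤ p) (hp' : p ≤ 1) (x y : V) :
    (transportCosts G (idleMass G p x) (idleMass G p y)).Nonempty := by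
  have hd' : (d : ℝ) ≠ 0 := Nat.cast_ne_zero.2 hd.ne'
  refine transportCosts_nonempty (s := ballUnion G x y) (fun _ => idleMass_eq_zero_left)
    (fun _ => idleMass_eq_zero_right) (idleMass_nonneg hp hp' x) (idleMass_nonneg hp hp' y) ?_ ?_
  · have h := sum_mul_idleMass_left hreg p x y fun _ => 1
    simp only [one_mul, Finset.sum_const, SimpleGraph.card_neighborFinset_eq_degree, hreg x,
      nsmul_eq_mul] at h
    rw [h]
    field_simp
    ring
  · have h := sum_mul_idleMass_right hreg p x y fun _ => 1
    simp only [one_mul, Finset.sum_const, SimpleGraph.card_neighborFinset_eq_degree, hreg y,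
      nsmul_eq_mul] at h
    rw [h]
    field_simp
    ring

theorem le_wasserstein_idleMass {d : ℕ} (hreg : G.IsRegularOfDegree d) (hd : 0 < d)
    {p : ℝ} (hp : 0 ≤ p) (hp' : p ≤ 1) (x y : V) {φ : V → ℝ}
    (hφ : ∀ u v, φ u - φ v ≤ G.dist u v) :
    (p * φ x + (1 - p) / d * ∑ u ∈ G.neighborFinset x, φ u) -
      (p * φ y + (1 - p) / d * ∑ u ∈ G.neighborFinset y, φ u) ≤
      wasserstein G (idleMass G p x) (idleMass G p y) := by
  refine le_csInf (transportCosts_idleMass_nonempty hreg hd hp hp' x y) fun c hc => ?_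
  rw [← sum_mul_idleMass_left hreg p x y, ← sum_mul_idleMass_right hreg p x y]
  exact le_of_mem_transportCosts (fun _ => idleMass_eq_zero_left)
    (fun _ => idleMass_eq_zero_right) hφ hc

/-- Without triangles N(x) and N(y) are disjoint, so the indicator of N(x) separates the two
measures completely. -/
theorem one_le_wasserstein_zero {d : ℕ} (hconn : G.Connected) (hreg : G.IsRegularOfDegree d)
    (hd : 0 < d) (hfree : G.CliqueFree 3) {x y : V} (hxy : G.Adj x y) :
    1 ≤ wasserstein G (idleMass G 0 x) (idleMass G 0 y) := by
  classical
  have h := le_wasserstein_idleMass hreg hd le_rfl zero_le_one x y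
    (indicator_sub_le_dist hconn {u | G.Adj x u})
  have h1 : ∑ u ∈ G.neighborFinset x, (if u ∈ {u | G.Adj x u} then (1 : ℝ) else 0) = d := by
    rw [Finset.sum_congr rfl fun u hu => if_pos (by simpa using hu)]
    simp [hreg x]
  have h2 : ∑ u ∈ G.neighborFinset y, (if u ∈ {u | G.Adj x u} then (1 : ℝ) else 0) = 0 :=
    Finset.sum_eq_zero fun u hu =>
      if_neg (not_adj_of_cliqueFree hfree hxy (by simpa using hu))
  have hd' : (d : ℝ) ≠ 0 := Nat.cast_ne_zero.2 hd.ne'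
  rw [h1, h2] at h
  simpa [hd'] using h

theorem le_wasserstein_of_cliqueFree {d : ℕ} (hconn : G.Connected) (hreg : G.IsRegularOfDegree d)
    (hd : 0 < d) (hfree : G.CliqueFree 3) {x y : V} (hxy : G.Adj x y) {p : ℝ} (hp : 0 ≤ p)
    (hp' : p ≤ 1) :
    1 - (1 - p) * (2 / d) ≤ wasserstein G (idleMass G p x) (idleMass G p y) := by
  classical
  -- This set has μ_x-mass p + (1 - p)(d - 1)/d and, by triangle-freeness, μ_y-mass (1 - p)/d from x
  -- alone.
  set A : Set V := {u | u = x ∨ (G.Adj x u ∧ u ≠ y)} with hA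
  have h := le_wasserstein_idleMass hreg hd hp hp' x y (indicator_sub_le_dist hconn A)
  have hx : x ∈ A := Or.inl rfl
  have hy : y ∉ A := by simp [hA, hxy.ne']
  have h1 : ∑ u ∈ G.neighborFinset x, (if u ∈ A then (1 : ℝ) else 0) = d - 1 := by
    have hyx : y ∈ G.neighborFinset x := by simpa using hxy
    have := Finset.add_sum_erase _ (fun u => if u ∈ A then (1 : ℝ) else 0) hyx
    rw [Finset.sum_congr rfl fun u hu => if_pos (by
      rw [Finset.mem_erase, SimpleGraph.mem_neighborFinset] at hu
      exact Or.inr ⟨hu.2, hu.1⟩)] at this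
    rw [← this, if_neg hy, Finset.sum_const, Finset.card_erase_of_mem hyx,
      SimpleGraph.card_neighborFinset_eq_degree, hreg x, nsmul_eq_mul,
      Nat.cast_sub (Nat.succ_le_of_lt hd)]
    simp
  have h2 : ∑ u ∈ G.neighborFinset y, (if u ∈ A then (1 : ℝ) else 0) = 1 := by
    rw [Finset.sum_eq_single_of_mem x (by simpa using hxy.symm), if_pos hx]
    intro u hu hux
    rw [SimpleGraph.mem_neighborFinset] at hu
    exact if_neg fun hu' => hu'.elim hux fun h' => not_adj_of_cliqueFree hfree hxy hu h'.1
  rw [if_pos hx, if_neg hy, h1, h2] at h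
  have hd' : (d : ℝ) ≠ 0 := Nat.cast_ne_zero.2 hd.ne'
  refine le_trans (le_of_eq ?_) h
  field_simp
  ring

/-- Convexity of `W₁(μ_x^p, μ_y^p)` in the idleness, on the segment from `p` to `1`. -/
theorem wasserstein_idleMass_le {d : ℕ} (hreg : G.IsRegularOfDegree d) (hd : 0 < d)
    {x y : V} (hxy : G.Adj x y) {p s : ℝ} (hp : 0 ≤ p) (hp' : p ≤ 1) (hs : 0 ≤ s) (hs' : s < 1) :
    wasserstein G (idleMass G ((1 - s) * p + s) x) (idleMass G ((1 - s) * p + s) y) ≤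
      (1 - s) * wasserstein G (idleMass G p x) (idleMass G p y) + s := by
  classical
  set W := wasserstein G (idleMass G ((1 - s) * p + s) x) (idleMass G ((1 - s) * p + s) y)
  have hs1 : 0 < 1 - s := by linarith
  have hmass : ∀ w u : V, idleMass G ((1 - s) * p + s) w u =
      (1 - s) * idleMass G p w u + if u = w then s else 0 := by
    intro w u
    simp only [idleMass_apply hreg]
    split_ifs <;> ring
  suffices (W - s) / (1 - s) ≤ wasserstein G (idleMass G p x) (idleMass G p y) by
    rw [div_le_iff₀ hs1] at this
    linarith
  refine le_csInf (transportCosts_idleMass_nonempty hreg hd hp hp' x y) ?_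
  rintro c ⟨π, h, hc⟩
  rw [div_le_iff₀ hs1]
  have hW : W ≤ (1 - s) * c + G.dist x y * s := by
    refine wasserstein_le ⟨fun u v => (1 - s) * π u v + pointPlan x y s u v,
      ⟨fun u v => ?_, fun u => ?_, fun v => ?_⟩, ?_⟩
    · exact add_nonneg (mul_nonneg hs1.le (h.nonneg u v)) (pointPlan_nonneg x y hs u v)
    · rw [hmass]
      exact ((h.fst u).mul_left _).add (hasSum_pointPlan_fst x y s u)
    · rw [hmass]
      exact ((h.snd v).mul_left _).add (hasSum_pointPlan_snd x y s v)
    · have hsum := (hc.mul_left (1 - s)).add (hasSum_pointPlan_cost (G := G) x y s)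
      simpa only [mul_add, mul_left_comm] using hsum
  rw [SimpleGraph.dist_eq_one_iff_adj.2 hxy] at hW
  push_cast at hW
  linarith

theorem ollivier_div_le_of_cliqueFree {d : ℕ} (hconn : G.Connected) (hreg : G.IsRegularOfDegree d)
    (hd : 0 < d) (hfree : G.CliqueFree 3) {x y : V} (hxy : G.Adj x y) {p : ℝ} (hp : 0 ≤ p)
    (hp' : p < 1) : ollivier G p x y / (1 - p) ≤ 2 / d := by
  rw [div_le_iff₀ (by linarith), ollivier]
  linarith [le_wasserstein_of_cliqueFree hconn hreg hd hfree hxy hp hp'.le]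

/-- Convexity of W₁ towards p = 1, where W₁ is 1 for an edge, says that 1 - W₁ shrinks no faster
than 1 - p. -/
theorem monotoneOn_ollivier_div {d : ℕ} (hreg : G.IsRegularOfDegree d) (hd : 0 < d) {x y : V}
    (hxy : G.Adj x y) :
    MonotoneOn (fun p : ℝ => ollivier G p x y / (1 - p)) (Set.Ioo 0 1) := by
  intro p hp q hq hpq
  have hp1 : 0 < 1 - p := by linarith [hp.2]
  have hq1 : 0 < 1 - q := by linarith [hq.2]
  -- The parameter s solves (1 - s)p + s = q.
  have h := wasserstein_idleMass_le hreg hd hxy (s := 1 - (1 - q) / (1 - p)) hp.1.le hp.2.le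
    (by rw [sub_nonneg, div_le_one hp1]; linarith) (by linarith [div_pos hq1 hp1])
  have hq' : (1 - (1 - (1 - q) / (1 - p))) * p + (1 - (1 - q) / (1 - p)) = q := by
    field_simp
    ring
  rw [hq'] at h
  change ollivier G p x y / (1 - p) ≤ ollivier G q x y / (1 - q)
  rw [le_div_iff₀ hq1]
  have e : ollivier G p x y / (1 - p) * (1 - q) = (1 - q) / (1 - p) * ollivier G p x y := by ring
  rw [e]
  unfold ollivier
  linarith

/-- The Lin-Lu-Yau curvature of an edge of a triangle-free regular graph exists and is at most
`2 / d`. -/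
theorem exists_isLLYCurvature {d : ℕ} (hconn : G.Connected) (hreg : G.IsRegularOfDegree d)
    (hd : 0 < d) (hfree : G.CliqueFree 3) {x y : V} (hxy : G.Adj x y) :
    ∃ κ : ℝ, IsLLYCurvature G x y κ ∧ κ ≤ 2 / d := by
  have hub : ∀ b ∈ (fun p : ℝ => ollivier G p x y / (1 - p)) '' Set.Ioo 0 1, b ≤ 2 / (d : ℝ) := by
    rintro _ ⟨p, hp, rfl⟩
    exact ollivier_div_le_of_cliqueFree hconn hreg hd hfree hxy hp.1.le hp.2
  have hne : (Set.Ioo (0 : ℝ) 1).Nonempty := Set.nonempty_Ioo.2 one_pos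
  exact ⟨_, (monotoneOn_ollivier_div hreg hd hxy).tendsto_nhdsWithin_Ioo_left hne ⟨_, hub⟩,
    csSup_le (hne.image _) hub⟩

/-! ### The fractional matching and sharp Ollivier curvature -/

section Matching

variable {c : ℕ} {x y : V}

open Classical in
/-- The fractional perfect matching between `N(x) \ {y}` and `N(y) \ {x}`. -/
noncomputable def matchingPlan (G : SimpleGraph V) (x y : V) (r : ℝ) (u v : V) : ℝ :=
  if (G.Adj x u ∧ u ≠ y) ∧ (G.Adj y v ∧ v ≠ x) ∧ G.Adj u v then r else 0

omit [G.LocallyFinite] in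
theorem matchingPlan_comm (r : ℝ) (u v : V) :
    matchingPlan G x y r u v = matchingPlan G y x r v u := by
  have h := G.adj_comm u v
  unfold matchingPlan
  split_ifs <;> first | rfl | (exfalso; tauto)

open Classical in
-- Such a u and y are nonadjacent with common neighbour x, so exactly c other common neighbours can
-- receive mass from u.
theorem sum_matchingPlan (hfree : G.CliqueFree 3) (h : HasConstantCommonNeighbors G c)
    (hxy : G.Adj x y) (r : ℝ) (u : V) :
    ∑ v ∈ (G.neighborFinset y).erase x, matchingPlan G x y r u v =
      if G.Adj x u ∧ u ≠ y then c * r else 0 := by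
  by_cases hu : G.Adj x u ∧ u ≠ y
  · have hcard := h.card_erase hu.2 (not_adj_of_cliqueFree hfree hu.1.symm hxy) hu.1.symm hxy
    simp only [matchingPlan]
    rw [← Finset.sum_filter, Finset.sum_const, nsmul_eq_mul, if_pos hu, ← hcard]
    congr 3
    ext v
    simp
    tauto
  · simp [matchingPlan, hu]

open Classical in
theorem hasSum_matchingPlan (hfree : G.CliqueFree 3) (h : HasConstantCommonNeighbors G c)
    (hxy : G.Adj x y) (r : ℝ) (u : V) :
    HasSum (fun v => matchingPlan G x y r u v) (if G.Adj x u ∧ u ≠ y then c * r else 0) := by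
  rw [← sum_matchingPlan hfree h hxy]
  refine hasSum_sum_of_ne_finset_zero fun v hv => if_neg fun h' => hv ?_
  simp [h'.2.1.1, h'.2.1.2]

theorem hasSum_matchingPlan_cost {d : ℕ} (hreg : G.IsRegularOfDegree d) (hfree : G.CliqueFree 3)
    (h : HasConstantCommonNeighbors G c) (hxy : G.Adj x y) (r : ℝ) :
    HasSum (fun q : V × V => (G.dist q.1 q.2 : ℝ) * matchingPlan G x y r q.1 q.2)
      ((d - 1) * (c * r)) := by
  classical
  have hd : 0 < d := by
    rw [← hreg x]
    exact (G.degree_pos_iff_exists_adj x).2 ⟨y, hxy⟩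
  have hcost : ∀ q : V × V, (G.dist q.1 q.2 : ℝ) * matchingPlan G x y r q.1 q.2 =
      matchingPlan G x y r q.1 q.2 := by
    intro q
    unfold matchingPlan
    split_ifs with hq
    · rw [SimpleGraph.dist_eq_one_iff_adj.2 hq.2.2, Nat.cast_one, one_mul]
    · rw [mul_zero]
  simp only [hcost]
  have hsum : ∑ q ∈ (G.neighborFinset x).erase y ×ˢ (G.neighborFinset y).erase x,
      matchingPlan G x y r q.1 q.2 = (d - 1) * (c * r) := by
    rw [Finset.sum_product, Finset.sum_congr rfl fun u hu => by
      rw [sum_matchingPlan hfree h hxy, if_pos (by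
        rw [Finset.mem_erase, SimpleGraph.mem_neighborFinset] at hu
        exact ⟨hu.2, hu.1⟩)], Finset.sum_const, Finset.card_erase_of_mem (by simpa using hxy),
      SimpleGraph.card_neighborFinset_eq_degree, hreg x, nsmul_eq_mul,
      Nat.cast_sub (Nat.succ_le_of_lt hd), Nat.cast_succ, Nat.cast_zero, zero_add]
  rw [← hsum]
  refine hasSum_sum_of_ne_finset_zero fun q hq => if_neg fun h' => hq ?_
  simp [h'.1.1, h'.1.2, h'.2.1.1, h'.2.1.2]

/-- Keeping the mass `e` at both `x` and `y`, exchanging the rest of the masses of `x` and `y`, and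
moving the remaining mass along the fractional perfect matching. -/
theorem wasserstein_idleMass_le_of_common {d : ℕ} (hreg : G.IsRegularOfDegree d)
    (hfree : G.CliqueFree 3) (hc : 0 < c) (h : HasConstantCommonNeighbors G c) (hxy : G.Adj x y)
    {p e : ℝ} (hp' : p ≤ 1) (he : 0 ≤ e) (hep : e ≤ p) (heq : e ≤ (1 - p) / d) :
    wasserstein G (idleMass G p x) (idleMass G p y) ≤ 1 - 2 * e := by
  classical
  set q : ℝ := (1 - p) / d with hq
  have hd : 0 < d := by
    rw [← hreg x]
    exact (G.degree_pos_iff_exists_adj x).2 ⟨y, hxy⟩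
  have hd' : (d : ℝ) ≠ 0 := Nat.cast_ne_zero.2 hd.ne'
  have hc' : (c : ℝ) ≠ 0 := Nat.cast_ne_zero.2 hc.ne'
  have hcq : c * (q / c) = q := mul_div_cancel₀ _ hc'
  have hdq : d * q = 1 - p := mul_div_cancel₀ _ hd'
  have hq0 : 0 ≤ q := div_nonneg (by linarith) (Nat.cast_nonneg _)
  -- The five pieces are the marginals of the five partial plans; the cost will be (p - e) + (q - e)
  -- + (d - 1)q = 1 - 2e.
  have hmass : ∀ {a b : V}, G.Adj a b → ∀ u, idleMass G p a u =
      (if u = a then p - e else 0) + (if u = b then q - e else 0) + (if u = a then e else 0) +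
        (if u = b then e else 0) + (if G.Adj a u ∧ u ≠ b then q else 0) := by
    intro a b hab u
    rw [idleMass_apply hreg, ← hq]
    by_cases h1 : u = a
    · subst h1
      simp [hab.ne]
    · by_cases h2 : u = b
      · subst h2
        simp [h1, hab]
      · simp [h1, h2]
  have hW : wasserstein G (idleMass G p x) (idleMass G p y) ≤
      G.dist x y * (p - e) + G.dist y x * (q - e) + G.dist x x * e + G.dist y y * e +
        (d - 1) * (c * (q / c)) := by
    refine wasserstein_le ⟨fun u v => pointPlan x y (p - e) u v + pointPlan y x (q - e) u v +
      pointPlan x x e u v + pointPlan y y e u v + matchingPlan G x y (q / c) u v,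
      ⟨fun u v => ?_, fun u => ?_, fun v => ?_⟩, ?_⟩
    · refine add_nonneg (add_nonneg (add_nonneg (add_nonneg ?_ ?_) ?_) ?_) ?_
      · exact pointPlan_nonneg _ _ (by linarith) _ _
      · exact pointPlan_nonneg _ _ (by linarith) _ _
      · exact pointPlan_nonneg _ _ he _ _
      · exact pointPlan_nonneg _ _ he _ _
      · unfold matchingPlan
        split_ifs
        · positivity
        · exact le_rfl
    · rw [hmass hxy u]
      have hm := hasSum_matchingPlan hfree h hxy (q / c) u
      rw [hcq] at hm
      exact ((((hasSum_pointPlan_fst _ _ _ _).add (hasSum_pointPlan_fst _ _ _ _)).add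
        (hasSum_pointPlan_fst _ _ _ _)).add (hasSum_pointPlan_fst _ _ _ _)).add hm
    · have hm := hasSum_matchingPlan hfree h hxy.symm (q / c) v
      simp only [hcq, matchingPlan_comm (x := y)] at hm
      convert ((((hasSum_pointPlan_snd x y (p - e) v).add (hasSum_pointPlan_snd y x (q - e) v)).add
        (hasSum_pointPlan_snd x x e v)).add (hasSum_pointPlan_snd y y e v)).add hm using 1
      rw [hmass hxy.symm v]
      ring
    · convert ((((hasSum_pointPlan_cost (G := G) x y (p - e)).add
        (hasSum_pointPlan_cost y x (q - e))).add
        (hasSum_pointPlan_cost x x e)).add (hasSum_pointPlan_cost y y e)).add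
        (hasSum_matchingPlan_cost hreg hfree h hxy (q / c)) using 1
      funext q
      dsimp only
      ring
  rw [SimpleGraph.dist_eq_one_iff_adj.2 hxy, SimpleGraph.dist_eq_one_iff_adj.2 hxy.symm, hcq,
    SimpleGraph.dist_self, SimpleGraph.dist_self] at hW
  push_cast at hW
  linarith

theorem ollivier_zero_eq_zero {d : ℕ} (hconn : G.Connected) (hreg : G.IsRegularOfDegree d)
    (hfree : G.CliqueFree 3) (hc : 0 < c) (h : HasConstantCommonNeighbors G c) (hxy : G.Adj x y) :
    ollivier G 0 x y = 0 := by
  have hd : 0 < d := by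
    rw [← hreg x]
    exact (G.degree_pos_iff_exists_adj x).2 ⟨y, hxy⟩
  have h1 := one_le_wasserstein_zero hconn hreg hd hfree hxy
  have h2 := wasserstein_idleMass_le_of_common hreg hfree hc h hxy zero_le_one le_rfl le_rfl
    (by positivity)
  unfold ollivier
  linarith

/-- Once p > 1/2 the largest admissible e is (1 - p)/d, and the quotient already equals 2/d before
passing to the limit. -/
theorem isLLYCurvature_of_common {d : ℕ} (hconn : G.Connected) (hreg : G.IsRegularOfDegree d)
    (hfree : G.CliqueFree 3) (hc : 0 < c) (h : HasConstantCommonNeighbors G c) (hxy : G.Adj x y) :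
    IsLLYCurvature G x y (2 / d) := by
  have hd : 0 < d := by
    rw [← hreg x]
    exact (G.degree_pos_iff_exists_adj x).2 ⟨y, hxy⟩
  have hd1 : (1 : ℝ) ≤ d := by exact_mod_cast hd
  refine tendsto_const_nhds.congr' ?_
  filter_upwards [Ioo_mem_nhdsLT (show (1 / 2 : ℝ) < 1 by norm_num)] with p hp
  have hp1 : 0 < 1 - p := by linarith [hp.2]
  have hq : (1 - p) / d ≤ p := (div_le_self hp1.le hd1).trans (by linarith [hp.1])
  refine le_antisymm ?_ (ollivier_div_le_of_cliqueFree hconn hreg hd hfree hxy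
    (by linarith [hp.1]) hp.2)
  have hW := wasserstein_idleMass_le_of_common hreg hfree hc h hxy hp.2.le
    (div_nonneg hp1.le (Nat.cast_nonneg _)) hq le_rfl
  rw [le_div_iff₀ hp1, ollivier]
  have e : 2 / (d : ℝ) * (1 - p) = 2 * ((1 - p) / d) := by ring
  linarith

end Matching

/-! ### Consequences of girth 4 and distance-regularity -/

theorem cliqueFree_three_of_girth_eq_four {V : Type*} {G : SimpleGraph V} (hg : G.girth = 4) :
    G.CliqueFree 3 := by
  intro s hs
  obtain ⟨u, w, hw, hlen⟩ := (SimpleGraph.is3Clique_iff_exists_cycle_length_three).1 ⟨s, hs⟩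
  have := SimpleGraph.girth_le_length hw
  omega

theorem exists_four_cycle_of_girth_eq_four {V : Type*} {G : SimpleGraph V} (hg : G.girth = 4) :
    ∃ a b c e : V, G.Adj a b ∧ G.Adj b c ∧ G.Adj c e ∧ G.Adj e a ∧ a ≠ c ∧ b ≠ e := by
  -- `girth` takes the default value 0 on acyclic graphs.
  have hac : ¬ G.IsAcyclic := fun h => by
    rw [SimpleGraph.girth_eq_zero.2 h] at hg
    omega
  obtain ⟨a, w, hw, hlen⟩ := SimpleGraph.exists_girth_eq_length.2 hac
  rw [hg] at hlen
  have hnodup := hw.support_nodup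
  match w, hlen, hnodup with
  | .cons (v := b) h1 (.cons (v := c) h2 (.cons (v := e) h3 (.cons h4 .nil))), _, hnodup =>
    simp at hnodup
    exact ⟨a, b, c, e, h1, h2, h3, h4, fun h => by subst h; simp_all, fun h => by subst h; simp_all⟩

theorem IsDistanceRegular.exists_hasConstantCommonNeighbors (hdr : IsDistanceRegular G)
    (hg : G.girth = 4) : ∃ c, 0 < c ∧ HasConstantCommonNeighbors G c := by
  classical
  obtain ⟨-, N, hN⟩ := hdr
  have hfree := cliqueFree_three_of_girth_eq_four hg
  have hcard : ∀ u v w : V, u ≠ v → ¬ G.Adj u v → G.Adj u w → G.Adj w v →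
      (G.neighborFinset u ∩ G.neighborFinset v).card = N 1 1 2 := by
    intro u v w huv hadj huw hwv
    have hdist : G.dist u v = 2 := by
      have h1 : G.dist u v ≤ 2 :=
        SimpleGraph.dist_le (SimpleGraph.Walk.cons huw (SimpleGraph.Walk.cons hwv .nil))
      have h2 : G.dist u v ≠ 1 := fun h => hadj (SimpleGraph.dist_eq_one_iff_adj.1 h)
      have h3 := (huw.reachable.trans hwv.reachable).pos_dist_of_ne huv
      omega
    have h := hN u v 1 1
    rw [hdist] at h
    have hset : {z : V | G.dist u z = 1 ∧ G.dist v z = 1} =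
        (G.neighborFinset u ∩ G.neighborFinset v : Finset V) := by
      ext z
      simp [SimpleGraph.dist_eq_one_iff_adj]
    rw [hset, Set.encard_coe_eq_coe_finsetCard] at h
    exact_mod_cast h
  obtain ⟨a, b, c, e, hab, hbc, hce, hea, hac, hbe⟩ := exists_four_cycle_of_girth_eq_four hg
  -- The opposite vertices a, c of a 4-cycle have the two common neighbours b, e, which makes c + 1
  -- ≥ 2 in the common-neighbour count.
  have h2 : 1 < N 1 1 2 := by
    rw [← hcard a c b hac (not_adj_of_cliqueFree hfree hab hbc) hab hbc, Finset.one_lt_card]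
    exact ⟨b, by simp [hab, hbc.symm], e, by simp [hea.symm, hce], hbe⟩
  refine ⟨N 1 1 2 - 1, by omega, fun u v w h1 h3 h4 h5 => ?_⟩
  rw [hcard u v w h1 h3 h4 h5]
  omega

end GraphCurvature

theorem theorem6p2 {V : Type*} (G : SimpleGraph V) [G.LocallyFinite] (hconn : G.Connected)
    (d : ℕ) (hreg : G.IsRegularOfDegree d) :
    (GraphCurvature.IsDistanceRegular G → G.girth = 4 →
      (∀ x y : V, G.Adj x y →
        GraphCurvature.ollivier G 0 x y = 0 ∧
        GraphCurvature.IsLLYCurvature G x y (2 / (d : ℝ))) ∧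
      (∀ x : V, GraphCurvature.IsBECurvatureInfty G x 2)) ∧
    (0 < d → G.CliqueFree 3 →
      (∀ x y : V, G.Adj x y →
        GraphCurvature.ollivier G 0 x y ≤ 0 ∧
        ∃ κ : ℝ, GraphCurvature.IsLLYCurvature G x y κ ∧ κ ≤ 2 / (d : ℝ)) ∧
      (∀ x : V, ∃ k : ℝ, GraphCurvature.IsBECurvatureInfty G x k ∧ k ≤ 2)) := by
  refine ⟨fun hdr hg => ?_, fun hd hfree => ⟨fun x y hxy => ⟨?_,
    GraphCurvature.exists_isLLYCurvature hconn hreg hd hfree hxy⟩,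
    GraphCurvature.exists_isBECurvatureInfty hreg hd hfree⟩⟩
  · have hfree := GraphCurvature.cliqueFree_three_of_girth_eq_four hg
    obtain ⟨c, hc, h⟩ := hdr.exists_hasConstantCommonNeighbors hg
    obtain ⟨a, b, -, -, hab, -⟩ := GraphCurvature.exists_four_cycle_of_girth_eq_four hg
    have hd : 0 < d := by
      rw [← hreg a]
      exact (G.degree_pos_iff_exists_adj a).2 ⟨b, hab⟩
    exact ⟨fun x y hxy => ⟨GraphCurvature.ollivier_zero_eq_zero hconn hreg hfree hc h hxy,
      GraphCurvature.isLLYCurvature_of_common hconn hreg hfree hc h hxy⟩,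
      GraphCurvature.isBECurvatureInfty_two hreg hd hc hfree h⟩
  · have h := GraphCurvature.one_le_wasserstein_zero hconn hreg hd hfree hxy
    unfold GraphCurvature.ollivier
    linarith
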